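/- All graphs are finite, simple and have at least one vertex. For a graph $G$ write $|G|=|V(G)|$. The lexicographic product $G[H]$ has vertex set $V(G)\times V(H)$, with $(g,h)$ and $(g',h')$ adjacent if and only if $gg'\in E(G)$, or $g=g'$ and $hh'\in E(H)$. A linear forest is a forest whose components are paths (isolated vertices allowed), and $\pi(H)$ denotes the maximum number of edges of a spanning linear forest of $H$. A graph is hamiltonian if it has a Hamiltonian cycle, and traceable if it has a Hamiltonian path. Let $G$ and $H$ be graphs with $|G|\ge 2$, and suppose that $G$ has a Hamiltonian path and that $|G|=2k+1$ for an integer $k$. (i) If $\dfrac{|H|}{k+1}\le \pi(H)$, then $G[H]$ is hamiltonian. (ii) If $\dfrac{|H|-1}{k+1}\le \pi(H)$, then $G[H]$ is traceable. -/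

import Mathlib

namespace LexHam

/-- The lexicographic product `G[H]`: `(g, h)` and `(g', h')` are adjacent iff `g g'` is an edge
of `G`, or `g = g'` and `h h'` is an edge of `H`. -/
def lexProduct {V W : Type*} (G : SimpleGraph V) (H : SimpleGraph W) : SimpleGraph (V × W) where
  Adj x y := G.Adj x.1 y.1 ∨ (x.1 = y.1 ∧ H.Adj x.2 y.2)
  symm := ⟨by
    rintro x y (h | ⟨h, h'⟩)
    · exact Or.inl h.symm
    · exact Or.inr ⟨h.symm, h'.symm⟩⟩
  loopless := ⟨by
    rintro x (h | ⟨_, h⟩)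
    · exact h.ne rfl
    · exact h.ne rfl⟩

/-- A graph is traceable if it contains a Hamiltonian path. -/
def IsTraceable {V : Type*} [DecidableEq V] (G : SimpleGraph V) : Prop :=
  ∃ (u v : V) (p : G.Walk u v), p.IsHamiltonian

/-- A linear forest is a forest all of whose components are paths. -/
def IsLinearForest {W : Type*} (F : SimpleGraph W) : Prop :=
  F.IsAcyclic ∧ ∀ c : F.ConnectedComponent,
    ∃ m : ℕ, Nonempty (c.toSimpleGraph ≃g SimpleGraph.pathGraph m)

/-- The possible numbers of edges of spanning linear forests of `H`. A graph `F ≤ H` on the same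
vertex type is exactly a spanning subgraph of `H`. -/
def linearForestSizes {W : Type*} (H : SimpleGraph W) : Set ℕ :=
  {m | ∃ F : SimpleGraph W, F ≤ H ∧ IsLinearForest F ∧ F.edgeSet.ncard = m}

/-- `π(H)`: the maximum number of edges of a spanning linear forest of the finite graph `H`
(the maximum is attained, see `maxLinearForest_isGreatest`). -/
noncomputable def maxLinearForest {W : Type*} (H : SimpleGraph W) : ℕ :=
  sSup (linearForestSizes H)

theorem isLinearForest_bot {W : Type*} : IsLinearForest (⊥ : SimpleGraph W) := by
  refine ⟨SimpleGraph.isAcyclic_bot, fun c => ⟨1, ?_⟩⟩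
  obtain ⟨w, hw⟩ := c.exists_rep
  have key : ∀ x : c, x.1 = w := by
    intro x
    have h1 : (⊥ : SimpleGraph W).connectedComponentMk x.1 = c := x.2
    exact SimpleGraph.reachable_bot.1 (SimpleGraph.ConnectedComponent.exact (h1.trans hw.symm))
  have hsub : Subsingleton c := ⟨fun x y => Subtype.ext ((key x).trans (key y).symm)⟩
  have : Unique c := { default := ⟨w, hw⟩, uniq := fun x => hsub.elim _ _ }
  refine ⟨⟨Equiv.ofUnique c (Fin 1), ?_⟩⟩
  intro a b
  rw [Subsingleton.elim a b]
  exact iff_of_false (SimpleGraph.irrefl _) (SimpleGraph.irrefl _)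

theorem maxLinearForest_isGreatest {W : Type*} [Finite W] (H : SimpleGraph W) :
    IsGreatest (linearForestSizes H) (maxLinearForest H) := by
  have hne : (linearForestSizes H).Nonempty := ⟨_, ⊥, bot_le, isLinearForest_bot, rfl⟩
  have hbdd : BddAbove (linearForestSizes H) := by
    refine ⟨H.edgeSet.ncard, ?_⟩
    rintro m ⟨F, hF, -, rfl⟩
    exact Set.ncard_le_ncard (SimpleGraph.edgeSet_mono hF) (Set.toFinite _)
  exact ⟨Nat.sSup_mem hne hbdd, fun m hm => le_csSup hbdd hm⟩

end LexHam

/-! Let `n = |H|` and let `ν 0, …, ν (2k)` be a Hamiltonian path of `G`. A block, meaning a path of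
`H` placed in one layer, may be followed by any block of a layer adjacent in `G`, whatever their end
vertices. The odd layers are cut into `kn` single vertices; each even layer is cut into any chosen
number of paths from `n - π(H)` to `n` (`exists_isPathPartition`). The `k + 1` even layers can thus
save up to `(k + 1) π(H)` blocks. Under (i) exactly `n` are saved, leaving `kn` even blocks against
`kn` odd ones; under (ii) `n - 1` are saved, leaving one extra even block.

List the even blocks `t₀, t₁, …` and the odd blocks `o₀, o₁, …` in order of layer. The savings are
spread (`exists_partialSums`) so that the lists stay in step: blocks at nearby positions lie in
adjacent layers (`adj_layers`). Alternating `t₀, o₀, t₁, …` proves (ii). For (i) that order would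
end far from its start, so the cycle goes out along `t₀, o₁, t₂, …` and returns along `…, t₁, o₀`
(`cycleWeave`). -/

namespace LexHam

/-! ### Path partitions and linear forests -/

/-- A list of nonempty paths of `H` that together contain every vertex exactly once. -/
structure IsPathPartition {W : Type*} (H : SimpleGraph W) (L : List (List W)) : Prop where
  ne_nil : ∀ l ∈ L, l ≠ []
  isChain : ∀ l ∈ L, l.IsChain H.Adj
  nodup : L.flatten.Nodup
  mem_flatten : ∀ w, w ∈ L.flatten

variable {W : Type*} {H : SimpleGraph W}

theorem IsPathPartition.length_flatten [Fintype W] {L : List (List W)}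
    (hL : IsPathPartition H L) : L.flatten.length = Fintype.card W := by
  classical
  rw [← List.toFinset_card_of_nodup hL.nodup, ← Finset.card_univ]
  congr 1
  ext w
  simpa using hL.mem_flatten w

/-- A path partition with fewer paths than vertices can be refined by cutting one path in two. -/
theorem IsPathPartition.exists_length_succ [Fintype W] {L : List (List W)}
    (hL : IsPathPartition H L) (hlt : L.length < Fintype.card W) :
    ∃ L', IsPathPartition H L' ∧ L'.length = L.length + 1 := by
  have hex : ∃ l ∈ L, 2 ≤ l.length := by
    by_contra! hcon
    have hle : (L.map List.length).sum ≤ (L.map fun _ => 1).sum :=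
      List.sum_le_sum fun l hl => by have := hcon l hl; omega
    have hlen := hL.length_flatten
    rw [List.length_flatten] at hlen
    simp at hle
    omega
  obtain ⟨l, hl, hl2⟩ := hex
  obtain ⟨A, B, rfl⟩ := List.append_of_mem hl
  obtain ⟨a, b, t, rfl⟩ : ∃ a b t, l = a :: b :: t := by
    match l, hl2 with
    | a :: b :: t, _ => exact ⟨a, b, t, rfl⟩
  have hc := hL.isChain _ hl
  have hfl : (A ++ [a] :: (b :: t) :: B).flatten = (A ++ (a :: b :: t) :: B).flatten := by simp
  refine ⟨A ++ [a] :: (b :: t) :: B, ⟨?_, ?_, hfl ▸ hL.nodup, hfl ▸ hL.mem_flatten⟩, ?_⟩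
  · intro l' hl'
    simp only [List.mem_append, List.mem_cons] at hl'
    rcases hl' with h | rfl | rfl | h
    · exact hL.ne_nil _ (by simp [h])
    · simp
    · simp
    · exact hL.ne_nil _ (by simp [h])
  · intro l' hl'
    simp only [List.mem_append, List.mem_cons] at hl'
    rcases hl' with h | rfl | rfl | h
    · exact hL.isChain _ (by simp [h])
    · simp
    · exact hc.of_cons
    · exact hL.isChain _ (by simp [h])
  · simp
    omega

theorem IsPathPartition.exists_length_eq [Fintype W] {L : List (List W)}
    (hL : IsPathPartition H L) {c : ℕ} (hc : L.length ≤ c) (hcW : c ≤ Fintype.card W) :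
    ∃ L', IsPathPartition H L' ∧ L'.length = c := by
  induction c, hc using Nat.le_induction with
  | base => exact ⟨L, hL, rfl⟩
  | succ c _ ih =>
    obtain ⟨L', hL', rfl⟩ := ih (by omega)
    exact hL'.exists_length_succ (by omega)

/-- The components of a spanning linear forest `F` form a path partition. -/
theorem IsLinearForest.exists_isPathPartition [Fintype W] {F : SimpleGraph W} (hFH : F ≤ H)
    (hF : IsLinearForest F) :
    ∃ L, IsPathPartition H L ∧ L.length + F.edgeSet.ncard ≤ Fintype.card W := by
  classical
  choose m φ using hF.2
  replace φ := fun c => (φ c).some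
  have hm : ∀ c, 0 < m c := fun c => by
    obtain ⟨w, hw⟩ := c.exists_rep
    exact Fin.pos (φ c ⟨w, hw⟩)
  let path : F.ConnectedComponent → List W := fun c =>
    (List.finRange (m c)).map fun i => ((φ c).symm i).1
  have hmem : ∀ c w, w ∈ path c ↔ F.connectedComponentMk w = c := by
    intro c w
    simp only [path, List.mem_map, List.mem_finRange, true_and]
    constructor
    · rintro ⟨i, rfl⟩
      exact ((φ c).symm i).2
    · intro h
      exact ⟨φ c ⟨w, h⟩, by simp⟩
  refine ⟨(Finset.univ : Finset F.ConnectedComponent).toList.map path, ⟨?_, ?_, ?_, ?_⟩, ?_⟩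
  · simp only [List.mem_map, forall_exists_index, and_imp]
    rintro l c - rfl h
    have := congrArg List.length h
    simp [path, (hm c).ne'] at this
  · simp only [List.mem_map, forall_exists_index, and_imp]
    rintro l c - rfl
    rw [List.isChain_iff_getElem]
    intro i hi
    simp only [path, List.getElem_map, List.getElem_finRange]
    apply hFH
    have : c.toSimpleGraph.Adj ((φ c).symm ⟨i, by simp [path] at hi; omega⟩)
        ((φ c).symm ⟨i + 1, by simpa [path] using hi⟩) := by
      rw [(φ c).symm.map_adj_iff, SimpleGraph.pathGraph_adj]
      simp
    exact this
  · rw [List.nodup_flatten]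
    constructor
    · simp only [List.mem_map, forall_exists_index, and_imp]
      rintro l c - rfl
      refine List.Nodup.map ?_ (List.nodup_finRange _)
      exact fun i j h => (φ c).symm.injective (Subtype.ext h)
    · rw [List.pairwise_map]
      refine (Finset.nodup_toList _).imp ?_
      intro c d hcd w hc hd
      exact hcd (((hmem c w).1 hc).symm.trans ((hmem d w).1 hd))
  · intro w
    rw [List.mem_flatten]
    exact ⟨_, List.mem_map_of_mem (Finset.mem_toList.2 (Finset.mem_univ _)), (hmem _ w).2 rfl⟩
  -- Each edge joins a vertex that is not the start of its path to its predecessor, so there are at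
  -- most `n` minus the number of components of them.
  · let start : F.ConnectedComponent → W := fun c => ((φ c).symm ⟨0, hm c⟩).1
    have hstart : ∀ c, F.connectedComponentMk (start c) = c := fun c =>
      ((φ c).symm ⟨0, hm c⟩).2
    have hinj : Function.Injective start := Function.LeftInverse.injective hstart
    -- At a start the truncated `0 - 1` makes `pred` return the vertex itself; starts are excluded
    -- below.
    let pred : W → W := fun w =>
      ((φ (F.connectedComponentMk w)).symm ⟨(φ (F.connectedComponentMk w) ⟨w, rfl⟩).1 - 1,
        by have := (φ (F.connectedComponentMk w) ⟨w, rfl⟩).2; omega⟩).1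
    have key : ∀ x y (c : F.ConnectedComponent) (hx : F.connectedComponentMk x = c)
        (hy : F.connectedComponentMk y = c), (φ c ⟨x, hx⟩).1 + 1 = (φ c ⟨y, hy⟩).1 →
        y ∈ (Set.range start)ᶜ ∧ pred y = x := by
      rintro x y c hx rfl h
      constructor
      · rintro ⟨d, rfl⟩
        have hd := hstart d
        -- The component is generalised to `e` because the type of `φ` depends on it.
        have : ∀ e (he : F.connectedComponentMk (start d) = e), d = e →
            (φ e ⟨start d, he⟩).1 = 0 := by
          rintro e he rfl
          have : (⟨start d, he⟩ : {w // w ∈ d}) = (φ d).symm ⟨0, hm d⟩ := rfl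
          exact congrArg Fin.val ((congrArg (φ d) this).trans ((φ d).apply_symm_apply _))
        have := this _ rfl hd.symm
        omega
      · have : (⟨(φ (F.connectedComponentMk y) ⟨y, rfl⟩).1 - 1,
            by have := (φ (F.connectedComponentMk y) ⟨y, rfl⟩).2; omega⟩ :
            Fin (m (F.connectedComponentMk y))) = φ (F.connectedComponentMk y) ⟨x, hx⟩ :=
          Fin.ext (by simp only; omega)
        simp only [pred]
        rw [this]
        simp
    have hsub : F.edgeSet ⊆ (fun w => s(w, pred w)) '' (Set.range start)ᶜ := by
      intro e
      induction e with | _ x y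
      intro hxy
      have hadj : F.Adj x y := hxy
      have hc : F.connectedComponentMk x = F.connectedComponentMk y :=
        SimpleGraph.ConnectedComponent.sound hadj.reachable
      have h1 : (F.connectedComponentMk y).toSimpleGraph.Adj ⟨x, hc⟩ ⟨y, rfl⟩ := hadj
      rw [← (φ (F.connectedComponentMk y)).map_adj_iff, SimpleGraph.pathGraph_adj] at h1
      rcases h1 with h1 | h1
      · obtain ⟨h2, h3⟩ := key _ _ _ _ _ h1
        exact ⟨y, h2, by simp only [h3]; exact Sym2.eq_swap⟩
      · obtain ⟨h2, h3⟩ := key _ _ _ _ _ h1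
        exact ⟨x, h2, by simp only [h3]⟩
    have h1 := (Set.ncard_le_ncard hsub (Set.toFinite _)).trans
      (Set.ncard_image_le (Set.toFinite _))
    have h2 := Set.ncard_add_ncard_compl (Set.range start)
    have h3 : (Set.range start).ncard = Fintype.card F.ConnectedComponent := by
      rw [← Set.image_univ, Set.ncard_image_of_injective _ hinj, Set.ncard_univ,
        Nat.card_eq_fintype_card]
    rw [Nat.card_eq_fintype_card] at h2
    simp only [List.length_map, Finset.length_toList, Finset.card_univ]
    omega

theorem exists_isPathPartition [Fintype W] (H : SimpleGraph W) {c : ℕ}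
    (hc : Fintype.card W ≤ c + maxLinearForest H) (hcW : c ≤ Fintype.card W) :
    ∃ L, IsPathPartition H L ∧ L.length = c := by
  obtain ⟨F, hFH, hF, hcard⟩ := (maxLinearForest_isGreatest H).1
  obtain ⟨L, hL, hlen⟩ := hF.exists_isPathPartition hFH
  exact hL.exists_length_eq (by omega) hcW

theorem maxLinearForest_lt_card [Fintype W] [Nonempty W] (H : SimpleGraph W) :
    maxLinearForest H < Fintype.card W := by
  obtain ⟨F, hFH, hF, hcard⟩ := (maxLinearForest_isGreatest H).1
  obtain ⟨L, hL, hlen⟩ := hF.exists_isPathPartition hFH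
  have : L ≠ [] := by
    rintro rfl
    simpa using hL.mem_flatten (Classical.arbitrary W)
  have := List.length_pos_iff.2 this
  omega

/-! ### Alternating arrangements of two lists -/

/-- `weave [t₀, t₁, …] [o₀, o₁, …] = [t₀, o₀, t₁, o₁, …]`. -/
def weave {α : Type*} : List α → List α → List α
  | t :: ts, o :: os => t :: o :: weave ts os
  | ts, [] => ts
  | [], os => os

theorem weave_perm {α : Type*} : ∀ ts os : List α, (weave ts os).Perm (ts ++ os)
  | t :: ts, o :: os => by
    rw [weave, List.cons_append]
    exact ((weave_perm ts os).cons o |>.trans List.perm_middle.symm).cons t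
  | ts, [] => by simp [weave]
  | [], o :: os => by simp [weave]

theorem isChain_weave {α : Type*} {R : α → α → Prop} :
    ∀ {ts os : List α}, ts.length = os.length + 1 →
    (∀ m (h₁ : m < ts.length) (h₂ : m < os.length), R ts[m] os[m]) →
    (∀ m (h₁ : m < os.length) (h₂ : m + 1 < ts.length), R os[m] ts[m + 1]) →
    (weave ts os).IsChain R
  | t :: t' :: ts, o :: os, hlen, h₁, h₂ => by
    have ih := isChain_weave (R := R) (ts := t' :: ts) (os := os) (by simpa using hlen)
      (fun m hm hm' => h₁ (m + 1) (by simpa using hm) (by simpa using hm'))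
      (fun m hm hm' => h₂ (m + 1) (by simpa using hm) (by simpa using hm'))
    rw [weave, List.isChain_cons_cons]
    refine ⟨h₁ 0 (by simp) (by simp), ?_⟩
    cases os with
    | nil => exact List.isChain_cons_cons.2 ⟨h₂ 0 (by simp) (by simp), ih⟩
    | cons o' os => exact List.isChain_cons_cons.2 ⟨h₂ 0 (by simp) (by simp), ih⟩
  | [t], [], _, _, _ => by simp [weave]

/-- `zigzag [t₀, t₁, …] [o₀, o₁, …] = [t₀, o₁, t₂, o₃, …]`. -/
def zigzag {α : Type*} : List α → List α → List α
  | t :: ts, _ :: os => t :: zigzag os ts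
  | _, _ => []
termination_by ts os => ts.length + os.length

theorem zigzag_append_perm {α : Type*} : ∀ {ts os : List α}, ts.length = os.length →
    (zigzag ts os ++ zigzag os ts).Perm (ts ++ os)
  | t :: ts, o :: os, h => by
    rw [zigzag, zigzag, List.cons_append, List.cons_append]
    refine List.Perm.cons t ?_
    refine List.perm_middle.trans (List.Perm.trans (List.Perm.cons o ?_) List.perm_middle.symm)
    exact List.perm_append_comm.trans (zigzag_append_perm (by simpa using h))
  | [], [], _ => by simp [zigzag]

theorem head?_zigzag {α : Type*} {ts os : List α} (h : ts.length = os.length) :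
    (zigzag ts os).head? = ts.head? := by
  cases ts <;> cases os <;> simp_all [zigzag]

theorem isChain_zigzag {α : Type*} {R : α → α → Prop} :
    ∀ {ts os : List α}, ts.length = os.length →
    (∀ m (h₁ : m < ts.length) (h₂ : m + 1 < os.length), R ts[m] os[m + 1]) →
    (∀ m (h₁ : m < os.length) (h₂ : m + 1 < ts.length), R os[m] ts[m + 1]) →
    (zigzag ts os).IsChain R
  | t :: ts, o :: os, hlen, h₁, h₂ => by
    have hlen' : os.length = ts.length := by simpa using hlen.symm
    rw [zigzag, List.isChain_cons]
    constructor
    · rw [head?_zigzag hlen']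
      cases os with
      | nil => simp
      | cons o' os =>
        intro y hy
        obtain rfl : o' = y := by simpa using hy
        exact h₁ 0 (by simp) (by simp)
    · exact isChain_zigzag hlen'
        (fun m hm hm' => h₂ (m + 1) (by simpa using hm) (by simpa using hm'))
        (fun m hm hm' => h₁ (m + 1) (by simpa using hm) (by simpa using hm'))
  | [], [], _, _, _ => by simp [zigzag]
termination_by ts os => ts.length + os.length

/-- This is the turning point of the cycle: the two zigzags end in the last entries of `ts` and
`os`, in an order depending on parity, hence the symmetry of `R`. -/
theorem rel_getLast?_zigzag {α : Type*} {R : α → α → Prop} (hR : ∀ x y, R x y → R y x) :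
    ∀ {ts os : List α}, ts.length = os.length →
    (∀ m (h₁ : m < ts.length) (h₂ : m < os.length), R ts[m] os[m]) →
    ∀ x ∈ (zigzag ts os).getLast?, ∀ y ∈ (zigzag os ts).getLast?, R x y
  | [t], [o], _, h₁ => by
    have := h₁ 0 (by simp) (by simp)
    simpa [zigzag] using this
  | t :: t' :: ts, o :: o' :: os, hlen, h₁ => by
    have ih := rel_getLast?_zigzag hR (ts := t' :: ts) (os := o' :: os) (by simpa using hlen)
      (fun m hm hm' => h₁ (m + 1) (by simpa using hm) (by simpa using hm'))
    intro x hx y hy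
    rw [zigzag, zigzag, List.getLast?_cons_cons, ← zigzag.eq_1 o' os t' ts] at hx
    rw [zigzag, zigzag, List.getLast?_cons_cons, ← zigzag.eq_1 t' ts o' os] at hy
    exact hR _ _ (ih y hy x hx)
  | [], [], _, _ => by simp [zigzag]

/-- The cyclic arrangement `[t₀, o₁, t₂, o₃, …, t₃, o₂, t₁, o₀]`. -/
def cycleWeave {α : Type*} (ts os : List α) : List α :=
  zigzag ts os ++ (zigzag os ts).reverse

theorem cycleWeave_perm {α : Type*} {ts os : List α} (h : ts.length = os.length) :
    (cycleWeave ts os).Perm (ts ++ os) :=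
  ((List.reverse_perm _).append_left _).trans (zigzag_append_perm h)

theorem isChain_cycleWeave {α : Type*} {R : α → α → Prop} (hR : ∀ x y, R x y → R y x)
    {ts os : List α} (hlen : ts.length = os.length)
    (h : ∀ m m' (h₁ : m < ts.length) (h₂ : m' < os.length), m ≤ m' + 1 → m' ≤ m + 1 →
      R ts[m] os[m']) : (cycleWeave ts os).IsChain R := by
  have h₁ : ∀ m (h₁ : m < ts.length) (h₂ : m + 1 < os.length), R ts[m] os[m + 1] :=
    fun m hm hm' => h m (m + 1) hm hm' (by omega) (by omega)
  have h₂ : ∀ m (h₁ : m < os.length) (h₂ : m + 1 < ts.length), R os[m] ts[m + 1] :=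
    fun m hm hm' => hR _ _ (h (m + 1) m hm' hm (by omega) (by omega))
  refine (isChain_zigzag hlen h₁ h₂).append ?_ ?_
  · rw [List.isChain_reverse]
    exact (isChain_zigzag hlen.symm h₂ h₁).imp fun x y => hR x y
  · rw [List.head?_reverse]
    exact rel_getLast?_zigzag hR hlen fun m hm hm' => h m m hm hm' (by omega) (by omega)

theorem head?_cycleWeave {α : Type*} {ts os : List α} (h : ts.length = os.length) :
    (cycleWeave ts os).head? = ts.head? := by
  cases ts <;> cases os <;> simp_all [cycleWeave, zigzag]

theorem getLast?_cycleWeave {α : Type*} {ts os : List α} (h : ts.length = os.length) :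
    (cycleWeave ts os).getLast? = os.head? := by
  cases ts <;> cases os
  · simp [cycleWeave, zigzag]
  · simp at h
  · simp at h
  · simp only [cycleWeave, zigzag, List.reverse_cons, ← List.append_assoc]
    rw [List.getLast?_append_of_ne_nil _ (by simp)]
    simp

/-! ### Hamiltonian paths and cycles from vertex lists -/

theorem nodup_of_length_eq_card {α : Type*} [Fintype α] [DecidableEq α] {l : List α}
    (hmem : ∀ a, a ∈ l) (hlen : l.length = Fintype.card α) : l.Nodup := by
  have : l.toFinset = Finset.univ := by ext; simp [hmem]
  rw [← Multiset.coe_nodup, ← Multiset.toFinset_card_eq_card_iff_nodup]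
  simp [this, hlen]

theorem isTraceable_of_list {α : Type*} [Fintype α] [DecidableEq α] [Nonempty α]
    {G : SimpleGraph α} {l : List α} (hl : l.IsChain G.Adj) (hmem : ∀ a, a ∈ l)
    (hlen : l.length = Fintype.card α) : IsTraceable G := by
  have hne : l ≠ [] := List.ne_nil_of_mem (hmem (Classical.arbitrary α))
  refine ⟨_, _, SimpleGraph.Walk.ofSupport l hne hl, fun a => ?_⟩
  rw [SimpleGraph.Walk.support_ofSupport]
  exact List.count_eq_one_of_mem (nodup_of_length_eq_card hmem hlen) (hmem a)

theorem isHamiltonian_of_list {α : Type*} [Fintype α] [DecidableEq α]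
    {G : SimpleGraph α} {l : List α} (hl : l.IsChain G.Adj) (hmem : ∀ a, a ∈ l)
    (hlen : l.length = Fintype.card α) (h3 : 3 ≤ l.length)
    (hclose : ∀ a ∈ l.head?, ∀ b ∈ l.getLast?, G.Adj b a) : G.IsHamiltonian := by
  intro _
  have hnd := nodup_of_length_eq_card hmem hlen
  have hne : l ≠ [] := by rintro rfl; simp at h3
  have hadj : G.Adj (l.getLast hne) (l.head hne) :=
    hclose _ (List.head?_eq_some_head hne) _ (List.getLast?_eq_some_getLast hne)
  let p := SimpleGraph.Walk.ofSupport l hne hl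
  have hp : p.support = l := SimpleGraph.Walk.support_ofSupport hne hl
  have hpath : p.IsPath := SimpleGraph.Walk.IsPath.mk' (hp.symm ▸ hnd)
  refine ⟨_, .cons hadj p, ?_⟩
  rw [SimpleGraph.Walk.isHamiltonianCycle_iff_isCycle_and_length_eq,
    SimpleGraph.Walk.cons_isCycle_iff]
  refine ⟨⟨hpath, ?_⟩, ?_⟩
  -- A path containing the edge between its own ends has length one, but here there are at least
  -- three vertices.
  · intro hmem
    have := hpath.length_eq_one_of_mem_edges (Sym2.eq_swap ▸ hmem)
    have : p.length = _ := SimpleGraph.Walk.length_ofSupport hne hl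
    omega
  · have : p.length = _ := SimpleGraph.Walk.length_ofSupport hne hl
    simp only [SimpleGraph.Walk.length_cons]
    omega

/-! ### Blocks labelled by layers -/

section Layers

variable {V W : Type*}

/-- The concatenation of the lists of blocks `Ls 0, …, Ls (r - 1)`, the blocks of `Ls i` being
labelled with the layer `f i`. -/
def layers (f : ℕ → ℕ) (Ls : ℕ → List (List W)) (r : ℕ) : List (ℕ × List W) :=
  (List.range r).flatMap fun i => (Ls i).map (Prod.mk (f i))

theorem layers_succ (f : ℕ → ℕ) (Ls : ℕ → List (List W)) (r : ℕ) :
    layers f Ls (r + 1) = layers f Ls r ++ (Ls r).map (Prod.mk (f r)) := by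
  simp [layers, List.range_succ]

/-- `s i` is the number of blocks saved in the layers before `i`; the identities are additive to
avoid truncated subtraction. -/
theorem length_layers {f : ℕ → ℕ} {Ls : ℕ → List (List W)} {s : ℕ → ℕ} {n : ℕ} (hs0 : s 0 = 0)
    (hs : ∀ i, (Ls i).length + s (i + 1) = n + s i) (r : ℕ) :
    (layers f Ls r).length + s r = r * n := by
  induction r with
  | zero => simp [layers, hs0]
  | succ r ih =>
    rw [layers_succ, List.length_append, List.length_map, Nat.succ_mul]
    have := hs r
    omega

/-- Layer `i` occupies the positions from `i * n - s i` up to, but excluding, `(i + 1) * n - s (i +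
1)`. -/
theorem layers_getElem {f : ℕ → ℕ} {Ls : ℕ → List (List W)} {s : ℕ → ℕ} {n : ℕ} (hs0 : s 0 = 0)
    (hs : ∀ i, (Ls i).length + s (i + 1) = n + s i) (r m : ℕ)
    (hm : m < (layers f Ls r).length) :
    ∃ i < r, (layers f Ls r)[m].1 = f i ∧ i * n ≤ m + s i ∧ m + s (i + 1) < (i + 1) * n := by
  induction r with
  | zero => simp [layers] at hm
  | succ r ih =>
    have hlen := length_layers (f := f) hs0 hs r
    have hlen' := length_layers (f := f) hs0 hs (r + 1)
    simp only [layers_succ f Ls r]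
    by_cases h : m < (layers f Ls r).length
    · obtain ⟨i, hi, h1, h2⟩ := ih h
      refine ⟨i, by omega, ?_, h2⟩
      rwa [List.getElem_append_left h]
    · refine ⟨r, by omega, ?_, by omega, by omega⟩
      rw [List.getElem_append_right (by omega)]
      simp

theorem mem_layers {f : ℕ → ℕ} {Ls : ℕ → List (List W)} {r : ℕ} {x : ℕ × List W} :
    x ∈ layers f Ls r ↔ ∃ i < r, x.1 = f i ∧ x.2 ∈ Ls i := by
  simp only [layers, List.mem_flatMap, List.mem_range, List.mem_map]
  constructor
  · rintro ⟨i, hi, b, hb, rfl⟩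
    exact ⟨i, hi, rfl, hb⟩
  · rintro ⟨i, hi, h1, h2⟩
    exact ⟨i, hi, x.2, h2, by rw [← h1]⟩

/-- Place a labelled block in the layer of the lexicographic product given by its label. -/
def expand (ν : ℕ → V) (x : ℕ × List W) : List (V × W) := x.2.map (Prod.mk (ν x.1))

theorem length_expand_layers [Fintype W] {H : SimpleGraph W} (ν : ℕ → V) (f : ℕ → ℕ)
    {Ls : ℕ → List (List W)} (hL : ∀ i, IsPathPartition H (Ls i)) (r : ℕ) :
    ((layers f Ls r).flatMap (expand ν)).length = r * Fintype.card W := by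
  induction r with
  | zero => simp [layers]
  | succ r ih =>
    have := (hL r).length_flatten
    rw [List.length_flatten] at this
    rw [layers_succ, List.flatMap_append, List.length_append, ih, Nat.succ_mul, List.length_flatMap,
      List.map_map, ← this]
    congr 3
    ext b
    simp [expand]

theorem isChain_expand {G : SimpleGraph V} {H : SimpleGraph W} {ν : ℕ → V}
    {Z : List (ℕ × List W)} (hne : ∀ x ∈ Z, x.2 ≠ []) (hch : ∀ x ∈ Z, x.2.IsChain H.Adj)
    (hZ : Z.IsChain fun x y => G.Adj (ν x.1) (ν y.1)) :
    (Z.flatMap (expand ν)).IsChain (lexProduct G H).Adj := by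
  rw [List.flatMap_def, List.isChain_flatten]
  · constructor
    · simp only [List.mem_map, forall_exists_index, and_imp]
      rintro l x hx rfl
      rw [expand, List.isChain_map]
      exact (hch x hx).imp fun a b h => Or.inr ⟨rfl, h⟩
    · rw [List.isChain_map]
      refine hZ.imp fun x y h a ha b hb => Or.inl ?_
      have ha' := List.mem_of_mem_getLast? ha
      have hb' := List.mem_of_mem_head? hb
      simp only [expand, List.mem_map] at ha' hb'
      obtain ⟨_, -, rfl⟩ := ha'
      obtain ⟨_, -, rfl⟩ := hb'
      exact h
  · simp only [List.mem_map, not_exists, not_and]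
    intro x hx h
    exact hne x hx (by simpa [expand] using h)

theorem fst_of_mem_head?_expand {ν : ℕ → V} {Z : List (ℕ × List W)} (hne : ∀ x ∈ Z, x.2 ≠ [])
    {a : V × W} (ha : a ∈ (Z.flatMap (expand ν)).head?) : ∃ x ∈ Z.head?, a.1 = ν x.1 := by
  cases Z with
  | nil => simp at ha
  | cons x Z =>
    obtain ⟨i, b⟩ := x
    cases b with
    | nil => exact absurd rfl (hne _ List.mem_cons_self)
    | cons w b =>
      refine ⟨_, rfl, ?_⟩
      simp [expand] at ha
      simp [← ha]

theorem fst_of_mem_getLast?_expand {ν : ℕ → V} {Z : List (ℕ × List W)} (hne : ∀ x ∈ Z, x.2 ≠ [])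
    {a : V × W} (ha : a ∈ (Z.flatMap (expand ν)).getLast?) : ∃ x ∈ Z.getLast?, a.1 = ν x.1 := by
  rcases List.eq_nil_or_concat Z with rfl | ⟨Z, x, rfl⟩
  · simp at ha
  · have hx : expand ν x ≠ [] := by
      have := hne x (by simp)
      simpa [expand] using this
    refine ⟨x, by simp, ?_⟩
    simp only [List.concat_eq_append, List.flatMap_append, List.flatMap_singleton] at ha
    rw [List.getLast?_append_of_ne_nil _ hx] at ha
    have ha' := List.mem_of_mem_getLast? ha
    simp only [expand, List.mem_map] at ha'
    obtain ⟨_, -, rfl⟩ := ha'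
    rfl

end Layers

/-! ### Assembling blocks and spreading the savings -/

theorem isPathPartition_singletons {W : Type*} [Fintype W] (H : SimpleGraph W) :
    IsPathPartition H ((Finset.univ : Finset W).toList.map fun w => [w]) where
  ne_nil := by simp
  isChain := by simp
  nodup := by
    rw [← List.flatMap_def, List.flatMap_singleton']
    exact Finset.nodup_toList _
  mem_flatten := by simp

/-- The even layers are cut into the paths `Ls i`, the odd layers into the single vertices `Os i`,
and `Z` is a rearrangement of all these blocks in which consecutive blocks lie in adjacent layers.
Then the vertices of `Z` form a Hamiltonian path of the lexicographic product. -/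
theorem list_of_blocks {V W : Type*} [Fintype V] [Fintype W] {G : SimpleGraph V}
    {H : SimpleGraph W} {k : ℕ} (hG : Fintype.card V = 2 * k + 1) {ν : ℕ → V}
    (hν : ∀ v, ∃ i ≤ 2 * k, ν i = v) {Ls Os : ℕ → List (List W)}
    (hL : ∀ i, IsPathPartition H (Ls i)) (hO : ∀ i, IsPathPartition H (Os i))
    {Z : List (ℕ × List W)}
    (hperm : Z.Perm (layers (fun i => 2 * i) Ls (k + 1) ++ layers (fun i => 2 * i + 1) Os k))
    (hZ : Z.IsChain fun x y => G.Adj (ν x.1) (ν y.1)) :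
    (∀ x ∈ Z, x.2 ≠ []) ∧ (Z.flatMap (expand ν)).IsChain (lexProduct G H).Adj ∧
      (∀ a, a ∈ Z.flatMap (expand ν)) ∧
      (Z.flatMap (expand ν)).length = Fintype.card (V × W) := by
  have hgood : ∀ x ∈ Z, x.2 ≠ [] ∧ x.2.IsChain H.Adj := by
    intro x hx
    rw [hperm.mem_iff, List.mem_append, mem_layers, mem_layers] at hx
    rcases hx with ⟨i, -, -, h⟩ | ⟨i, -, -, h⟩
    · exact ⟨(hL i).ne_nil _ h, (hL i).isChain _ h⟩
    · exact ⟨(hO i).ne_nil _ h, (hO i).isChain _ h⟩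
  have hne : ∀ x ∈ Z, x.2 ≠ [] := fun x hx => (hgood x hx).1
  refine ⟨hne, isChain_expand hne (fun x hx => (hgood x hx).2) hZ, ?_, ?_⟩
  · rintro ⟨v, w⟩
    obtain ⟨j, hj, rfl⟩ := hν v
    suffices h : ∃ b, (j, b) ∈ Z ∧ w ∈ b by
      obtain ⟨b, hb, hw⟩ := h
      exact List.mem_flatMap.2 ⟨_, hb, List.mem_map_of_mem hw⟩
    simp only [hperm.mem_iff, List.mem_append, mem_layers]
    obtain ⟨i, rfl | rfl⟩ := Nat.even_or_odd' j
    · obtain ⟨b, hb, hw⟩ := List.mem_flatten.1 ((hL i).mem_flatten w)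
      exact ⟨b, Or.inl ⟨i, by omega, rfl, hb⟩, hw⟩
    · obtain ⟨b, hb, hw⟩ := List.mem_flatten.1 ((hO i).mem_flatten w)
      exact ⟨b, Or.inr ⟨i, by omega, rfl, hb⟩, hw⟩
  · rw [(hperm.flatMap_right _).length_eq, List.flatMap_append, List.length_append,
      length_expand_layers ν _ hL, length_expand_layers ν _ hO, Fintype.card_prod, hG]
    ring

/-- If the numbers of paths in the even layers are governed by `s`, then blocks with nearby
positions in the two lists lie in adjacent layers. -/
theorem adj_layers {V W : Type*} {G : SimpleGraph V} {k n : ℕ} {ν : ℕ → V}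
    (hν : ∀ i < 2 * k, G.Adj (ν i) (ν (i + 1))) {Ls Os : ℕ → List (List W)} {s : ℕ → ℕ}
    (hs0 : s 0 = 0) (hL : ∀ i, (Ls i).length + s (i + 1) = n + s i)
    (hO : ∀ i, (Os i).length = n) (hsk : ∀ i ≤ k, s i + 1 ≤ n) {m m' : ℕ}
    (hm : m < (layers (fun i => 2 * i) Ls (k + 1)).length)
    (hm' : m' < (layers (fun i => 2 * i + 1) Os k).length) (h₁ : m ≤ m' + 1)
    (h₂ : m' ≤ m ∨ m' ≤ m + 1 ∧ ∀ i, 1 ≤ s (i + 1)) :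
    G.Adj (ν (layers (fun i => 2 * i) Ls (k + 1))[m].1)
      (ν (layers (fun i => 2 * i + 1) Os k)[m'].1) := by
  obtain ⟨i, hi, hi0, hi1, hi2⟩ := layers_getElem (f := fun i => 2 * i) hs0 hL (k + 1) m hm
  obtain ⟨j, hj, hj0, hj1, hj2⟩ := layers_getElem (f := fun i => 2 * i + 1) (s := fun _ => 0)
    (n := n) rfl (fun i => by simp [hO i]) k m' hm'
  rw [hi0, hj0]
  simp only [add_zero] at hj1 hj2
  -- If `i < j`, then `m < (i + 1) * n - s (i + 1)` and `(i + 1) * n ≤ m'`, so `m'` exceeds `m`, and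
  -- exceeds `m + 1` once something is saved.
  have h3 : j ≤ i := by
    by_contra! hlt
    have : (i + 1) * n ≤ j * n := Nat.mul_le_mul_right n hlt
    rcases h₂ with h₂ | ⟨h₂, h₄⟩
    · omega
    · have := h₄ i
      omega
  -- If `j + 2 ≤ i`, then `m ≤ m' + 1 ≤ (j + 1) * n`, while `s i < n` puts the start of layer `i`
  -- beyond that.
  have h4 : i ≤ j + 1 := by
    by_contra! hlt
    have h5 : (j + 1 + 1) * n ≤ i * n := Nat.mul_le_mul_right n hlt
    have := hsk i (by omega)
    rw [Nat.succ_mul] at h5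
    omega
  obtain rfl | rfl : i = j ∨ i = j + 1 := by omega
  · exact hν _ (by omega)
  · exact (hν (2 * j + 1) (by omega)).symm

/-- A way to distribute `N` among `k + 1` layers with at most `q` in each, by partial sums. -/
theorem exists_partialSums {k n N q : ℕ} (hn : 1 ≤ n) (hq : n ≤ N → 1 ≤ q) (hN : N ≤ n)
    (hN' : n ≤ N + 1) (hNq : N ≤ (k + 1) * q) :
    ∃ s : ℕ → ℕ, s 0 = 0 ∧ (∀ i, s i ≤ s (i + 1)) ∧ (∀ i, s (i + 1) ≤ s i + q) ∧
      (∀ i, s i ≤ N) ∧ (∀ i ≤ k, s i + 1 ≤ n) ∧ s (k + 1) = N ∧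
      (2 ≤ n → 1 ≤ q → ∀ i, 1 ≤ s (i + 1)) := by
  -- Save greedily, `q` per layer, capped at `n - 1` to keep `s i < n` for `i ≤ k`. The last layer
  -- saves the rest: at most `q` if the cap was not reached, at most one otherwise.
  refine ⟨fun i => if i ≤ k then min (i * q) (n - 1) else N, ?_⟩
  have hmul : ∀ i, (i + 1) * q = i * q + q := fun i => Nat.succ_mul i q
  refine ⟨by simp, fun i => ?_, fun i => ?_, fun i => ?_, fun i hi => ?_, by simp,
    fun hn2 hq1 i => ?_⟩
  · have := hmul i
    dsimp only
    split_ifs <;> omega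
  · have := hmul i
    dsimp only
    split_ifs with h1 h2
    · omega
    · omega
    · obtain rfl : i = k := by omega
      omega
    · omega
  · dsimp only
    split_ifs <;> omega
  · simp only [hi, if_true]
    omega
  · have := hmul i
    dsimp only
    split_ifs <;> omega

/-! ### The two conclusions for the lexicographic product -/

section LexProduct

variable {V W : Type*} [Fintype V] [Fintype W]

theorem exists_layer_partitions (H : SimpleGraph W) {s : ℕ → ℕ}
    (hs : ∀ i, s i ≤ s (i + 1)) (hs' : ∀ i, s (i + 1) ≤ s i + maxLinearForest H)
    (hsW : ∀ i, s i ≤ Fintype.card W) :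
    ∃ Ls : ℕ → List (List W), (∀ i, IsPathPartition H (Ls i)) ∧
      ∀ i, (Ls i).length + s (i + 1) = Fintype.card W + s i := by
  have h : ∀ i, ∃ L, IsPathPartition H L ∧ L.length + s (i + 1) = Fintype.card W + s i := by
    intro i
    have h1 := hs i
    have h2 := hs' i
    have h3 := hsW (i + 1)
    obtain ⟨L, hL, hlen⟩ := exists_isPathPartition H
      (c := Fintype.card W + s i - s (i + 1)) (by omega) (by omega)
    exact ⟨L, hL, by omega⟩
  choose Ls hLs using h
  exact ⟨Ls, fun i => (hLs i).1, fun i => (hLs i).2⟩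

theorem IsTraceable.exists_enumeration [DecidableEq V] {G : SimpleGraph V} {k : ℕ}
    (hG : Fintype.card V = 2 * k + 1) (hpath : IsTraceable G) :
    ∃ ν : ℕ → V, (∀ v, ∃ i ≤ 2 * k, ν i = v) ∧ ∀ i < 2 * k, G.Adj (ν i) (ν (i + 1)) := by
  obtain ⟨u, v, p, hp⟩ := hpath
  have hlen : p.length = 2 * k := by rw [hp.length_eq, hG]; rfl
  refine ⟨p.getVert, fun x => ?_, fun i hi => p.adj_getVert_succ (hlen ▸ hi)⟩
  obtain ⟨i, hi, hle⟩ := SimpleGraph.Walk.mem_support_iff_exists_getVert.1 (hp.mem_support x)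
  exact ⟨i, hlen ▸ hle, hi⟩

variable [DecidableEq V] [DecidableEq W] [Nonempty W] {G : SimpleGraph V} {H : SimpleGraph W}
  {k : ℕ}

theorem isHamiltonian_lexProduct (hk : 1 ≤ k) (hG : Fintype.card V = 2 * k + 1)
    (hpath : IsTraceable G) (h : Fintype.card W ≤ (k + 1) * maxLinearForest H) :
    (lexProduct G H).IsHamiltonian := by
  obtain ⟨ν, hν, hadj⟩ := hpath.exists_enumeration hG
  have hW : 1 ≤ Fintype.card W := Fintype.card_pos
  have hq : 1 ≤ maxLinearForest H := Nat.pos_of_ne_zero fun h0 => by simp [h0] at h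
  -- With `hq` this gives `n ≥ 2`, so that the capped sums `s (i + 1)` are positive, as the outward
  -- and return zigzags require.
  have hlt := maxLinearForest_lt_card H
  obtain ⟨s, hs0, hs, hs', hsN, hsk, hskN, hs1⟩ :=
    exists_partialSums (k := k) hW (fun _ => hq) le_rfl (Nat.le_succ _) h
  obtain ⟨Ls, hL, hLlen⟩ := exists_layer_partitions H hs hs' hsN
  let Os : ℕ → List (List W) := fun _ => (Finset.univ : Finset W).toList.map fun w => [w]
  have hOlen : ∀ i, (Os i).length = Fintype.card W := fun i => by simp [Os]
  have hTlen := length_layers (f := fun i => 2 * i) hs0 hLlen (k + 1)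
  have hUlen := length_layers (f := fun i => 2 * i + 1) (Ls := Os) (s := fun _ => 0)
    (n := Fintype.card W) rfl hOlen k
  have hlen : (layers (fun i => 2 * i) Ls (k + 1)).length =
      (layers (fun i => 2 * i + 1) Os k).length := by
    rw [Nat.succ_mul] at hTlen
    omega
  have hadj' := fun m m' hm hm' h₁ h₂ =>
    adj_layers hadj hs0 hLlen hOlen hsk (m := m) (m' := m') hm hm' h₁
      (Or.inr ⟨h₂, hs1 (by omega) hq⟩)
  obtain ⟨hne, hch, hmem, hcard⟩ := list_of_blocks hG hν hL
    (fun _ => isPathPartition_singletons H) (cycleWeave_perm hlen)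
    (isChain_cycleWeave (R := fun x y => G.Adj (ν x.1) (ν y.1)) (fun _ _ h => h.symm) hlen hadj')
  refine isHamiltonian_of_list hch hmem hcard ?_ fun a ha b hb => Or.inl ?_
  · rw [hcard, Fintype.card_prod, hG]
    nlinarith
  · obtain ⟨x, hx, hax⟩ := fst_of_mem_head?_expand hne ha
    obtain ⟨y, hy, hby⟩ := fst_of_mem_getLast?_expand hne hb
    rw [hax, hby]
    rw [head?_cycleWeave hlen] at hx
    rw [getLast?_cycleWeave hlen] at hy
    obtain ⟨hx0, rfl⟩ := List.getElem?_eq_some_iff.1 (List.head?_eq_getElem?.symm.trans hx)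
    obtain ⟨hy0, rfl⟩ := List.getElem?_eq_some_iff.1 (List.head?_eq_getElem?.symm.trans hy)
    -- The cycle closes through `o₀` and `t₀`.
    exact (hadj' 0 0 hx0 hy0 (by simp) (by simp)).symm

theorem isTraceable_lexProduct (hG : Fintype.card V = 2 * k + 1)
    (hpath : IsTraceable G) (h : Fintype.card W ≤ (k + 1) * maxLinearForest H + 1) :
    IsTraceable (lexProduct G H) := by
  obtain ⟨ν, hν, hadj⟩ := hpath.exists_enumeration hG
  have : Nonempty V := ⟨ν 0⟩
  have hW : 1 ≤ Fintype.card W := Fintype.card_pos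
  obtain ⟨s, hs0, hs, hs', hsN, hsk, hskN, -⟩ :=
    exists_partialSums (k := k) (n := Fintype.card W) (N := Fintype.card W - 1)
      (q := maxLinearForest H) hW (by omega) (by omega) (by omega) (by omega)
  obtain ⟨Ls, hL, hLlen⟩ := exists_layer_partitions H hs hs' fun i =>
    (hsN i).trans (Nat.sub_le _ _)
  let Os : ℕ → List (List W) := fun _ => (Finset.univ : Finset W).toList.map fun w => [w]
  have hOlen : ∀ i, (Os i).length = Fintype.card W := fun i => by simp [Os]
  have hTlen := length_layers (f := fun i => 2 * i) hs0 hLlen (k + 1)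
  have hUlen := length_layers (f := fun i => 2 * i + 1) (Ls := Os) (s := fun _ => 0)
    (n := Fintype.card W) rfl hOlen k
  have hlen : (layers (fun i => 2 * i) Ls (k + 1)).length =
      (layers (fun i => 2 * i + 1) Os k).length + 1 := by
    rw [Nat.succ_mul] at hTlen
    omega
  have hchain := isChain_weave (R := fun x y => G.Adj (ν x.1) (ν y.1)) hlen
    (fun m hm hm' => adj_layers hadj hs0 hLlen hOlen hsk hm hm' (by omega) (Or.inl le_rfl))
    (fun m hm hm' =>
      (adj_layers hadj hs0 hLlen hOlen hsk hm' hm le_rfl (Or.inl (Nat.le_succ _))).symm)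
  obtain ⟨-, hch, hmem, hcard⟩ := list_of_blocks hG hν hL
    (fun _ => isPathPartition_singletons H) (weave_perm _ _) hchain
  exact isTraceable_of_list hch hmem hcard

end LexProduct

end LexHam

theorem mainTheorem7 {V W : Type*} [Fintype V] [DecidableEq V] [Fintype W] [DecidableEq W]
    [Nonempty W] (G : SimpleGraph V) (H : SimpleGraph W) (k : ℕ)
    (hG2 : 2 ≤ Fintype.card V) (hG : Fintype.card V = 2 * k + 1)
    (hpath : LexHam.IsTraceable G) :
    ((Fintype.card W : ℝ) / ((k : ℝ) + 1) ≤ (LexHam.maxLinearForest H : ℝ) →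
      (LexHam.lexProduct G H).IsHamiltonian) ∧
    (((Fintype.card W : ℝ) - 1) / ((k : ℝ) + 1) ≤ (LexHam.maxLinearForest H : ℝ) →
      LexHam.IsTraceable (LexHam.lexProduct G H)) := by
  have hk : (0 : ℝ) < (k : ℝ) + 1 := by positivity
  refine ⟨fun h => LexHam.isHamiltonian_lexProduct (by omega) hG hpath ?_,
    fun h => LexHam.isTraceable_lexProduct hG hpath ?_⟩
  · rw [div_le_iff₀' hk] at h
    exact_mod_cast h
  · rw [div_le_iff₀' hk, sub_le_iff_le_add] at h
    exact_mod_cast h
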